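/- Let $R$ be a commutative ring with unit and let $Y$ be a path-connected, locally simply connected topological space with universal covering $\pi:X\to Y$ and fundamental group $\Gamma$, acting on $X$ by deck transformations. Let $C\to Y$ be a normal (connected) covering and let $\Sigma\subset\Gamma$ be the normal subgroup given by the fundamental group of $C$. Let $A=R[\Gamma]$ with augmentation ideal $I$, let $AI_\Sigma$ be the ideal of $A$ generated by the elements $\sigma-1$, $\sigma\in\Sigma$, and put $J_k=I^k+AI_\Sigma$ for $k\ge 0$. For an $A$-module $V$ and $q\ge 0$ let $$H^0_{q,\Sigma}(\Gamma,V)=\{v\in V:\ I^{q+1}v=0,\ \sigma v=v\ \text{for all }\sigma\in\Sigma\}.$$ For a sheaf $\mathcal F$ of $R$-modules on $Y$ put $H^0_{q,C}(Y,\mathcal F)=H^0_{q,\Sigma}(\Gamma,H^0(X,\pi^*\mathcal F))$, and let $H^p_{q,C}(Y,\cdot)$, $p\ge 0$, be the right derived functors of the functor $H^0_{q,C}(Y,\cdot)$ from sheaves of $R$-modules on $Y$ to $R$-modules. Let $H^p(Y,\cdot)$ be the right derived functors of the global sections functor $H^0(Y,\cdot)$. A sheaf $\mathcal F$ is called acyclic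 for one of these functors if its right derived functors in all degrees $p\ge 1$ vanish at $\mathcal F$. Assume that $X$ is contractible. (a) For each $p\ge 0$ there is an isomorphism $H^p_{0,C}(Y,\mathcal F)\cong H^p(Y,\mathcal F)$, natural in $\mathcal F$. (b) Let $q\ge 0$ and assume that the $R$-modules $J_k/J_{k+1}$, $1\le k\le q$, are free (which is automatic if $R$ is a field). If a sheaf $\mathcal F$ of $R$-modules on $Y$ is $H^0(Y,\cdot)$-acyclic, then it is $H^0_{q,C}(Y,\cdot)$-acyclic. -/

import Mathlib

open CategoryTheory TopologicalSpace Opposite Topology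

universe u

noncomputable section

namespace HigherOrder

/-! ### Higher order invariants of a group representation -/

section Algebra

variable (R : Type u) [CommRing R] {Γ : Type u} [Group Γ]

/-- The augmentation ideal of the group algebra `R[Γ]`: the kernel of the `R`-algebra map
`R[Γ] → R` sending every group element to `1`. -/
def augIdeal (Γ : Type u) [Group Γ] : Ideal (MonoidAlgebra R Γ) :=
  RingHom.ker (MonoidAlgebra.lift R R Γ (1 : Γ →* R))

/-- The (left, in fact two-sided if `N` is normal) ideal `A I_N` of `A = R[Γ]` generated by the
augmentation ideal of the subgroup `N`, i.e. by the elements `σ - 1` with `σ ∈ N`. -/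
def relAugIdeal (N : Subgroup Γ) : Ideal (MonoidAlgebra R Γ) :=
  Ideal.span {a | ∃ σ ∈ N, a = MonoidAlgebra.of R Γ σ - 1}

/-- The ideal `J_k = I ^ k + A I_N`. -/
def idealJ (N : Subgroup Γ) (k : ℕ) : Ideal (MonoidAlgebra R Γ) :=
  augIdeal R Γ ^ k ⊔ relAugIdeal R N

/-- The `R`-module `J_k / J_{k+1}`. -/
abbrev gradedJ (N : Subgroup Γ) (k : ℕ) : Type u :=
  ((idealJ R N k).restrictScalars R) ⧸
    ((idealJ R N (k + 1)).restrictScalars R).submoduleOf ((idealJ R N k).restrictScalars R)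

variable {R} {V W : Type u} [AddCommGroup V] [Module R V] [AddCommGroup W] [Module R W]

/-- The invariants of order `q` of a representation of `Γ` on `V`, relative to `N`: all `v ∈ V`
with `I ^ (q + 1) v = 0` and `σ v = v` for every `σ ∈ N`. -/
def higherInvariants (ρ : Representation R Γ V) (N : Subgroup Γ) (q : ℕ) : Submodule R V where
  carrier := {v | (∀ a ∈ augIdeal R Γ ^ (q + 1), ρ.asAlgebraHom a v = 0) ∧ ∀ σ ∈ N, ρ σ v = v}
  add_mem' := by
    rintro v w ⟨hv, hv'⟩ ⟨hw, hw'⟩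
    exact ⟨fun a ha => by rw [map_add, hv a ha, hw a ha, add_zero],
      fun σ hσ => by rw [map_add, hv' σ hσ, hw' σ hσ]⟩
  zero_mem' := ⟨fun a _ => map_zero _, fun σ _ => map_zero _⟩
  smul_mem' := by
    rintro c v ⟨hv, hv'⟩
    exact ⟨fun a ha => by rw [map_smul, hv a ha, smul_zero],
      fun σ hσ => by rw [map_smul, hv' σ hσ]⟩

/-- Equivariant maps preserve higher order invariants. -/
theorem map_mem_higherInvariants {ρ : Representation R Γ V} {τ : Representation R Γ W}
    (f : V →ₗ[R] W) (hf : ∀ γ v, f (ρ γ v) = τ γ (f v)) (N : Subgroup Γ) (q : ℕ) {v : V}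
    (hv : v ∈ higherInvariants ρ N q) : f v ∈ higherInvariants τ N q := by
  have key : ∀ (a : MonoidAlgebra R Γ) (v : V), f (ρ.asAlgebraHom a v) = τ.asAlgebraHom a (f v) := by
    intro a v
    induction a using MonoidAlgebra.induction_on with
    | of g => simp [hf]
    | add a b ha hb => simp [ha, hb]
    | smul r a ha => simp [ha]
  exact ⟨fun a ha => by rw [← key, hv.1 a ha, map_zero],
    fun σ hσ => by rw [← hf, hv.2 σ hσ]⟩

end Algebra

/-! ### Covering spaces -/

section Covering

/-- A space is locally simply connected if every point has a neighbourhood basis of simply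
connected neighbourhoods. -/
class LocallySimplyConnectedSpace (Y : Type u) [TopologicalSpace Y] : Prop where
  exists_nhds : ∀ (y : Y), ∀ U ∈ 𝓝 y, ∃ V ∈ 𝓝 y, V ⊆ U ∧ SimplyConnectedSpace V

theorem LocallySimplyConnectedSpace.locallyPathConnectedSpace (Y : Type u) [TopologicalSpace Y]
    [LocallySimplyConnectedSpace Y] : LocallyPathConnectedSpace Y where
  path_connected_basis y := by
    refine ⟨fun U => ⟨fun hU => ?_, fun ⟨V, ⟨hV, _⟩, hVU⟩ => Filter.mem_of_superset hV hVU⟩⟩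
    obtain ⟨V, hV, hVU, hs⟩ := LocallySimplyConnectedSpace.exists_nhds y U hU
    exact ⟨V, ⟨hV, isPathConnected_iff_pathConnectedSpace.2 inferInstance⟩, hVU⟩

variable {X Y C : Type u} [TopologicalSpace X] [TopologicalSpace Y] [TopologicalSpace C]

theorem locallyPathConnectedSpace_of_isLocalHomeomorph [LocallyPathConnectedSpace Y] {π : X → Y}
    (hπ : IsLocalHomeomorph π) : LocallyPathConnectedSpace X := by
  rw [locallyPathConnectedSpace_iff_pathComponentIn_mem_nhds]
  intro x u hu hxu
  obtain ⟨e, hxe, he⟩ := hπ x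
  have hs : LocallyPathConnectedSpace e.target := e.open_target.locallyPathConnectedSpace
  have hs' : LocallyPathConnectedSpace e.source :=
    e.toHomeomorphSourceTarget.isOpenEmbedding.locallyPathConnectedSpace
  obtain ⟨t, ⟨ht, htc⟩, htu⟩ := (hs'.path_connected_basis ⟨x, hxe⟩).mem_iff.1
    ((hu.preimage continuous_subtype_val).mem_nhds (show (⟨x, hxe⟩ : e.source) ∈ _ from hxu))
  refine Filter.mem_of_superset (e.open_source.isOpenEmbedding_subtypeVal.image_mem_nhds.2 ht) ?_
  exact (htc.image continuous_subtype_val).subset_pathComponentIn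
    ⟨_, mem_of_mem_nhds ht, rfl⟩ (Set.image_subset_iff.2 htu)

/-- A normal (regular) covering: a covering map with path-connected total space whose group of
deck transformations acts transitively on each fibre. -/
structure IsNormalCovering (p : C → Y) : Prop where
  isCoveringMap : IsCoveringMap p
  pathConnected : PathConnectedSpace C
  exists_deck : ∀ c c' : C, p c = p c' → ∃ φ : C ≃ₜ C, (∀ z, p (φ z) = p z) ∧ φ c = c'

/-- For a covering `p : C → Y` with `p c₀ = y₀`, the fundamental group of `C` at `c₀`, viewed as
a subgroup of the fundamental group of `Y` at `y₀`. -/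
def coveringSubgroup {p : C → Y} (hp : IsCoveringMap p) {c₀ : C} {y₀ : Y} (h : p c₀ = y₀) :
    Subgroup (FundamentalGroup Y y₀) :=
  (FundamentalGroup.mapOfEq ⟨p, hp.continuous⟩ h).range

/-- Deck transformations commute with monodromy. -/
theorem map_monodromy {π : X → Y} (hπ : IsCoveringMap π) {F : C(X, X)}
    (hF : ∀ x, π (F x) = π x) {y z : Y} (γ : Path.Homotopic.Quotient y z) (e : X) (he : π e = y) :
    F (hπ.monodromy γ ⟨e, he⟩).1 = (hπ.monodromy γ ⟨F e, (hF e).trans he⟩).1 := by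
  obtain ⟨γ⟩ := γ
  have h₀ : γ 0 = π e := γ.source.trans he.symm
  have h₁ : γ 0 = π (F e) := h₀.trans (hF e).symm
  have key : F.comp (hπ.liftPath γ e h₀) = hπ.liftPath γ (F e) h₁ := by
    refine (hπ.eq_liftPath_iff' h₁).2 ⟨funext fun t => ?_, ?_⟩
    · exact (hF _).trans (congrFun (hπ.liftPath_lifts γ e h₀) t)
    · exact congrArg F (hπ.liftPath_zero γ e h₀)
  exact DFunLike.congr_fun key 1

variable [SimplyConnectedSpace X] [LocallySimplyConnectedSpace Y] {π : X → Y}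

theorem existsUnique_deckMap (hπ : IsCoveringMap π) (x₀ : X) (γ : FundamentalGroup Y (π x₀)) :
    ∃! F : C(X, X), F x₀ = (hπ.monodromy γ ⟨x₀, rfl⟩).1 ∧ π ∘ F = π := by
  have := LocallySimplyConnectedSpace.locallyPathConnectedSpace Y
  have := locallyPathConnectedSpace_of_isLocalHomeomorph hπ.isLocalHomeomorph
  exact hπ.existsUnique_continuousMap_lifts ⟨π, hπ.continuous⟩ x₀ _ (hπ.monodromy γ ⟨x₀, rfl⟩).2

variable (hπ : IsCoveringMap π) (x₀ : X)

/-- The map `X → X` over `Y` taking `x₀` to the end point of the lift of the loop `γ` starting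
at `x₀`. -/
def deckMap (γ : FundamentalGroup Y (π x₀)) : C(X, X) :=
  (existsUnique_deckMap hπ x₀ γ).choose

theorem deckMap_base (γ : FundamentalGroup Y (π x₀)) :
    deckMap hπ x₀ γ x₀ = (hπ.monodromy γ ⟨x₀, rfl⟩).1 :=
  (existsUnique_deckMap hπ x₀ γ).choose_spec.1.1

theorem proj_deckMap (γ : FundamentalGroup Y (π x₀)) (x : X) : π (deckMap hπ x₀ γ x) = π x :=
  congrFun (existsUnique_deckMap hπ x₀ γ).choose_spec.1.2 x

theorem eq_deckMap (γ : FundamentalGroup Y (π x₀)) (F : C(X, X))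
    (h₀ : F x₀ = (hπ.monodromy γ ⟨x₀, rfl⟩).1) (h : ∀ x, π (F x) = π x) :
    F = deckMap hπ x₀ γ :=
  (existsUnique_deckMap hπ x₀ γ).choose_spec.2 F ⟨h₀, funext h⟩

theorem deckMap_one : deckMap hπ x₀ 1 = ContinuousMap.id X := by
  refine (eq_deckMap hπ x₀ 1 _ ?_ fun _ => rfl).symm
  have := congrFun (hπ.monodromy_refl (x := π x₀)) ⟨x₀, rfl⟩
  exact (congrArg Subtype.val this).symm

theorem deckMap_mul (γ δ : FundamentalGroup Y (π x₀)) :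
    deckMap hπ x₀ (γ * δ) = (deckMap hπ x₀ δ).comp (deckMap hπ x₀ γ) := by
  refine (eq_deckMap hπ x₀ _ _ ?_ fun x => ?_).symm
  · rw [ContinuousMap.comp_apply, deckMap_base, map_monodromy hπ (proj_deckMap hπ x₀ δ)]
    have h : (⟨deckMap hπ x₀ δ x₀, proj_deckMap hπ x₀ δ x₀⟩ : π ⁻¹' {π x₀}) =
        hπ.monodromy δ ⟨x₀, rfl⟩ := Subtype.ext (deckMap_base hπ x₀ δ)
    rw [h]
    exact (congrArg Subtype.val (hπ.monodromy_trans_apply δ γ ⟨x₀, rfl⟩)).symm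
  · simp [proj_deckMap]

/-- The identification of the fundamental group of `Y` with the group of deck transformations of
the universal covering `X → Y` determined by the base point `x₀`. As products of loops
are read from right to left here (`γ * δ` is `δ` followed by `γ`), an inverse is needed to
get a homomorphism: `γ` goes to the deck transformation that maps `x₀` to the end point of the lift
of the loop `γ⁻¹` starting at `x₀`. -/
def deckHom : FundamentalGroup Y (π x₀) →* (X ≃ₜ X) where
  toFun γ :=
    { toFun := deckMap hπ x₀ γ⁻¹
      invFun := deckMap hπ x₀ γ
      left_inv := fun x => by
        rw [← ContinuousMap.comp_apply, ← deckMap_mul, inv_mul_cancel, deckMap_one]; rfl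
      right_inv := fun x => by
        rw [← ContinuousMap.comp_apply, ← deckMap_mul, mul_inv_cancel, deckMap_one]; rfl
      continuous_toFun := (deckMap hπ x₀ γ⁻¹).continuous
      continuous_invFun := (deckMap hπ x₀ γ).continuous }
  map_one' := by
    ext x
    change deckMap hπ x₀ 1⁻¹ x = x
    rw [inv_one, deckMap_one]; rfl
  map_mul' γ δ := by
    ext x
    change deckMap hπ x₀ (γ * δ)⁻¹ x = deckMap hπ x₀ γ⁻¹ (deckMap hπ x₀ δ⁻¹ x)
    rw [mul_inv_rev, deckMap_mul]; rfl

theorem proj_deckHom (γ : FundamentalGroup Y (π x₀)) (x : X) : π (deckHom hπ x₀ γ x) = π x :=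
  proj_deckMap hπ x₀ γ⁻¹ x

end Covering

/-! ### Global sections of an inverse image sheaf -/

section Sheaves

variable {R : Type u} [CommRing R] {Y : TopCat.{u}} {X : Type u} [TopologicalSpace X]

/-- `H⁰(X, π^* F)`: the `R`-module of global sections of the inverse image sheaf of `F` along `π`.
A section assigns to each `x : X` an element of the stalk `(π^* F)_x = F_{π x}`, and near
each point of `X` these elements are the germs of a single section of `F`. -/
def pullbackSections (π : X → Y) (F : TopCat.Sheaf (ModuleCat.{u} R) Y) :
    Submodule R (∀ x : X, F.presheaf.stalk (π x)) where
  carrier := {s | ∀ x : X, ∃ (V : Opens Y) (t : F.presheaf.obj (op V)), ∃ U ∈ 𝓝 x, ∀ z ∈ U,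
    ∃ h : π z ∈ V, s z = F.presheaf.germ V (π z) h t}
  add_mem' := by
    intro s s' hs hs' x
    obtain ⟨V, t, U, hU, h⟩ := hs x
    obtain ⟨V', t', U', hU', h'⟩ := hs' x
    refine ⟨V ⊓ V', F.presheaf.map (homOfLE inf_le_left).op t +
      F.presheaf.map (homOfLE inf_le_right).op t', U ∩ U', Filter.inter_mem hU hU', ?_⟩
    rintro z ⟨hz, hz'⟩
    obtain ⟨hzV, e⟩ := h z hz
    obtain ⟨hzV', e'⟩ := h' z hz'
    refine ⟨⟨hzV, hzV'⟩, ?_⟩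
    rw [map_add, Pi.add_apply, e, e']
    erw [TopCat.Presheaf.germ_res_apply, TopCat.Presheaf.germ_res_apply]
  zero_mem' := fun x => ⟨⊤, 0, Set.univ, Filter.univ_mem, fun z _ => ⟨trivial, by simp⟩⟩
  smul_mem' := by
    intro c s hs x
    obtain ⟨V, t, U, hU, h⟩ := hs x
    refine ⟨V, c • t, U, hU, fun z hz => ?_⟩
    obtain ⟨hzV, e⟩ := h z hz
    exact ⟨hzV, by rw [Pi.smul_apply, e, map_smul]⟩

/-- The map on sections of inverse images induced by a morphism of sheaves. -/
def pullbackSectionsMap (π : X → Y) {F G : TopCat.Sheaf (ModuleCat.{u} R) Y} (f : F ⟶ G) :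
    pullbackSections π F →ₗ[R] pullbackSections π G where
  toFun s := ⟨fun x => ((TopCat.Presheaf.stalkFunctor _ (π x)).map f.hom).hom (s.1 x), by
    intro x
    obtain ⟨V, t, U, hU, h⟩ := s.2 x
    refine ⟨V, f.hom.app (op V) t, U, hU, fun z hz => ?_⟩
    obtain ⟨hzV, e⟩ := h z hz
    refine ⟨hzV, ?_⟩
    refine (congrArg _ e).trans ?_
    exact TopCat.Presheaf.stalkFunctor_map_germ_apply V (π z) hzV f.hom t⟩
  map_add' s s' := Subtype.ext (funext fun x => map_add (ModuleCat.Hom.hom _) _ _)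
  map_smul' c s := Subtype.ext (funext fun x => map_smul (ModuleCat.Hom.hom _) _ _)

/-- The identification of the stalks of `F` at equal points. -/
def stalkCast (F : TopCat.Sheaf (ModuleCat.{u} R) Y) {y z : Y} (h : y = z) :
    F.presheaf.stalk y →ₗ[R] F.presheaf.stalk z :=
  (F.presheaf.stalkSpecializes (specializes_of_eq h.symm)).hom

theorem stalkCast_germ (F : TopCat.Sheaf (ModuleCat.{u} R) Y) {y z : Y} (h : y = z) (V : Opens Y)
    (hy : y ∈ V) (t : F.presheaf.obj (op V)) :
    stalkCast F h (F.presheaf.germ V y hy t) = F.presheaf.germ V z (h ▸ hy) t := by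
  subst h
  simp [stalkCast]

theorem stalkCast_rfl (F : TopCat.Sheaf (ModuleCat.{u} R) Y) {y : Y} (a : F.presheaf.stalk y) :
    stalkCast F rfl a = a := by
  simp [stalkCast]

theorem stalkCast_trans (F : TopCat.Sheaf (ModuleCat.{u} R) Y) {y z w : Y} (h : y = z) (h' : z = w)
    (a : F.presheaf.stalk y) : stalkCast F h' (stalkCast F h a) = stalkCast F (h.trans h') a := by
  subst h h'
  simp [stalkCast_rfl]

theorem stalkCast_section {Z : Type u} (F : TopCat.Sheaf (ModuleCat.{u} R) Y) {π : Z → Y}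
    (s : ∀ x, F.presheaf.stalk (π x)) {x x' : Z} (hx : x = x') :
    stalkCast F (congrArg π hx) (s x) = s x' := by
  subst hx
  exact stalkCast_rfl F _

variable [SimplyConnectedSpace X] [LocallySimplyConnectedSpace Y] {π : X → Y}
  (hπ : IsCoveringMap π) (x₀ : X)

/-- The action of the fundamental group `Γ` of `Y` on `H⁰(X, π^* F)` by deck transformations:
`(γ s)(x) = s(γ⁻¹ x)`, where the stalks `F_{π (γ⁻¹ x)}` and `F_{π x}` are identified by
the equality `π (γ⁻¹ x) = π x`. -/
def sectionsRep (F : TopCat.Sheaf (ModuleCat.{u} R) Y) :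
    Representation R (FundamentalGroup Y (π x₀)) (pullbackSections π F) where
  toFun γ :=
    { toFun := fun s => ⟨fun x =>
          stalkCast F (proj_deckHom hπ x₀ γ⁻¹ x) (s.1 (deckHom hπ x₀ γ⁻¹ x)), by
        intro x
        obtain ⟨V, t, U, hU, h⟩ := s.2 (deckHom hπ x₀ γ⁻¹ x)
        refine ⟨V, t, deckHom hπ x₀ γ⁻¹ ⁻¹' U,
          (deckHom hπ x₀ γ⁻¹).continuous.continuousAt hU, fun z hz => ?_⟩
        obtain ⟨hzV, e⟩ := h _ hz
        exact ⟨proj_deckHom hπ x₀ γ⁻¹ z ▸ hzV,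
          (congrArg _ e).trans (stalkCast_germ F _ V hzV t)⟩⟩
      map_add' := fun s s' => Subtype.ext (funext fun x => map_add (stalkCast F _) _ _)
      map_smul' := fun c s => Subtype.ext (funext fun x => map_smul (stalkCast F _) _ _) }
  map_one' := by
    refine LinearMap.ext fun s => Subtype.ext (funext fun x => ?_)
    refine stalkCast_section F s.1 (x := deckHom hπ x₀ 1⁻¹ x) ?_
    rw [inv_one, map_one]; rfl
  map_mul' γ δ := by
    refine LinearMap.ext fun s => Subtype.ext (funext fun x => ?_)
    have hx : deckHom hπ x₀ (γ * δ)⁻¹ x = deckHom hπ x₀ δ⁻¹ (deckHom hπ x₀ γ⁻¹ x) := by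
      rw [mul_inv_rev, map_mul]; rfl
    refine Eq.trans ?_ (stalkCast_trans F (proj_deckHom hπ x₀ δ⁻¹ (deckHom hπ x₀ γ⁻¹ x))
      (proj_deckHom hπ x₀ γ⁻¹ x) (s.1 (deckHom hπ x₀ δ⁻¹ (deckHom hπ x₀ γ⁻¹ x)))).symm
    rw [← stalkCast_section F s.1 hx, stalkCast_trans]
    rfl

theorem pullbackSectionsMap_sectionsRep {F G : TopCat.Sheaf (ModuleCat.{u} R) Y} (f : F ⟶ G)
    (γ : FundamentalGroup Y (π x₀)) (s : pullbackSections π F) :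
    pullbackSectionsMap π f (sectionsRep hπ x₀ F γ s) =
      sectionsRep hπ x₀ G γ (pullbackSectionsMap π f s) := by
  refine Subtype.ext (funext fun x => ?_)
  exact congr($(TopCat.Presheaf.stalkSpecializes_stalkFunctor_map f.hom
    (specializes_of_eq (proj_deckHom hπ x₀ γ⁻¹ x).symm)).hom (s.1 (deckHom hπ x₀ γ⁻¹ x)))

/-- The functor `F ↦ H⁰_{q,C}(Y, F) = H⁰_{q,Σ}(Γ, H⁰(X, π^* F))` from sheaves of `R`-modules on
`Y` to `R`-modules, where `Γ` is the fundamental group of `Y` and the subgroup `N = Σ` of `Γ` is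
the fundamental group of the covering `C` (see `coveringSubgroup`). -/
def higherSections (R : Type u) [CommRing R] (N : Subgroup (FundamentalGroup Y (π x₀))) (q : ℕ) :
    TopCat.Sheaf (ModuleCat.{u} R) Y ⥤ ModuleCat.{u} R where
  obj F := ModuleCat.of R (higherInvariants (sectionsRep hπ x₀ F) N q)
  map f := ModuleCat.ofHom ((pullbackSectionsMap π f).restrict fun _ hs =>
    map_mem_higherInvariants _ (pullbackSectionsMap_sectionsRep hπ x₀ f) N q hs)
  map_id F := by
    refine ModuleCat.hom_ext (LinearMap.ext fun s => Subtype.ext (Subtype.ext (funext fun x => ?_)))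
    exact congr($((TopCat.Presheaf.stalkFunctor (ModuleCat.{u} R) (π x)).map_id
      F.presheaf).hom (s.1.1 x))
  map_comp {F G H} f g := by
    refine ModuleCat.hom_ext (LinearMap.ext fun s => Subtype.ext (Subtype.ext (funext fun x => ?_)))
    exact congr($((TopCat.Presheaf.stalkFunctor (ModuleCat.{u} R) (π x)).map_comp
      f.hom g.hom).hom (s.1.1 x))

instance (N : Subgroup (FundamentalGroup Y (π x₀))) (q : ℕ) :
    (higherSections hπ x₀ R N q).Additive where
  map_add {F G f g} := by
    refine ModuleCat.hom_ext (LinearMap.ext fun s => Subtype.ext (Subtype.ext (funext fun x => ?_)))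
    exact congr($((TopCat.Presheaf.stalkFunctor (ModuleCat.{u} R) (π x)).map_add
      (f := f.hom) (g := g.hom)).hom (s.1.1 x))

/-- The global sections functor `F ↦ H⁰(Y, F)`. -/
def globalSections (R : Type u) [CommRing R] (Y : TopCat.{u}) :
    TopCat.Sheaf (ModuleCat.{u} R) Y ⥤ ModuleCat.{u} R :=
  TopCat.Sheaf.forget _ _ ⋙ (evaluation _ _).obj (op ⊤)

instance : (globalSections R Y).Additive where
  map_add := rfl

/-- An object `F` is acyclic for an additive functor `T` if the higher right derived functors
of `T` vanish at `F`. -/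
def IsAcyclicFor (T : TopCat.Sheaf (ModuleCat.{u} R) Y ⥤ ModuleCat.{u} R) [T.Additive]
    (F : TopCat.Sheaf (ModuleCat.{u} R) Y) : Prop :=
  ∀ p : ℕ, 1 ≤ p → Limits.IsZero ((T.rightDerived p).obj F)

/-- The functors `H^p(Y, ·)`. -/
def sheafCohomology (R : Type u) [CommRing R] (Y : TopCat.{u}) (p : ℕ) :
    TopCat.Sheaf (ModuleCat.{u} R) Y ⥤ ModuleCat.{u} R :=
  (globalSections R Y).rightDerived p

/-- The functors `H^p_{q,C}(Y, ·)`: the right derived functors of `H⁰_{q,C}(Y, ·)`. -/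
def higherSheafCohomology (R : Type u) [CommRing R] (N : Subgroup (FundamentalGroup Y (π x₀)))
    (q p : ℕ) : TopCat.Sheaf (ModuleCat.{u} R) Y ⥤ ModuleCat.{u} R :=
  (higherSections hπ x₀ R N q).rightDerived p

end Sheaves

end HigherOrder

end

/-!
Write `A = R[Γ]`, `M(F) = H⁰(X, π^* F)` and `T_q(F) = H⁰_{q,C}(Y, F)`, so that `T_q(F)` is the set
of elements of `M(F)` annihilated by `J_{q+1}`.

In order zero, `T_0(F)` is the module of `Γ`-invariant elements of `M(F)`. Since `Γ` acts
transitively on the fibres of the local homeomorphism `π`, such sections descend to `Y`: this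
identifies `T_0` with the global sections functor (`globalSectionsIso`), and hence the derived
functors of the two.

For higher orders, the main point is that `M(F)` is an injective `A`-module whenever `F` is an
injective sheaf (`exists_equivariant_extension`). This holds because morphisms from the local system
of a `Γ`-module `V` to `F` are the same as equivariant maps `V → M(F)`
(`exists_hom_of_linearMap`, `exists_linearMap_of_hom`), local systems of submodules are subpresheaves,
and an injective sheaf is injective as a presheaf. It is enough to work with presheaves, so the
local system never has to be shown to be a sheaf.

An element `v` of `T_{q+1}(F)` defines a homomorphism `J_{q+1} / J_{q+2} → T_0(F)`, `j ↦ j v`, which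
is zero exactly when `v` lies in `T_q(F)`. As `Γ` acts trivially on `J_{q+1} / J_{q+2}`,
injectivity of `M(F)` shows that for injective `F` there is a short exact sequence
`0 → T_q(F) → T_{q+1}(F) → Hom_R(J_{q+1} / J_{q+2}, T_0(F)) → 0` (`surjective_gradedAction`). Evaluate
it on an injective resolution of a sheaf. As `J_{q+1} / J_{q+2}` is free, the functor
`Hom_R(J_{q+1} / J_{q+2}, ·)` is exact, so acyclicity for `T_0` and `T_q` implies acyclicity for
`T_{q+1}`; the diagram chase is `exact_higherInvariants_succ`, and induction on `q` finishes the
proof (`isAcyclicFor_higherSections`).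
-/

noncomputable section

namespace HigherOrder

/-! ### The ideals `J_k` and higher order invariants -/

section Algebra

variable {R : Type u} [CommRing R] {Γ : Type u} [Group Γ]

theorem mul_mem_augIdeal_right {a b : MonoidAlgebra R Γ} (ha : a ∈ augIdeal R Γ) :
    a * b ∈ augIdeal R Γ := by
  rw [augIdeal, RingHom.mem_ker] at *
  rw [map_mul, ha, zero_mul]

theorem of_sub_one_mem_augIdeal (γ : Γ) : MonoidAlgebra.of R Γ γ - 1 ∈ augIdeal R Γ := by
  rw [augIdeal, RingHom.mem_ker]
  simp

theorem augIdeal_pow_succ (k : ℕ) : augIdeal R Γ ^ (k + 1) = augIdeal R Γ ^ k * augIdeal R Γ := by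
  rfl

/-- The powers of a left ideal are built by multiplying on the right; as the augmentation ideal
is two-sided, left multiplication by it also raises the exponent. -/
theorem mul_mem_augIdeal_pow_succ {k : ℕ} {a b : MonoidAlgebra R Γ} (ha : a ∈ augIdeal R Γ)
    (hb : b ∈ augIdeal R Γ ^ k) : a * b ∈ augIdeal R Γ ^ (k + 1) := by
  induction k generalizing b with
  | zero =>
    rw [zero_add, Submodule.pow_one]
    exact mul_mem_augIdeal_right ha
  | succ k ih =>
    rw [augIdeal_pow_succ] at hb ⊢
    refine Submodule.mul_induction_on hb (fun m hm n hn => ?_) fun x y hx hy => ?_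
    · rw [← mul_assoc]
      exact Ideal.mul_mem_mul (ih hm) hn
    · rw [mul_add]
      exact add_mem hx hy

theorem augIdeal_pow_succ_le (k : ℕ) : augIdeal R Γ ^ (k + 1) ≤ augIdeal R Γ ^ k := by
  induction k with
  | zero => exact le_top.trans_eq ((Submodule.pow_zero _).trans Ideal.one_eq_top).symm
  | succ k ih => exact Ideal.mul_mono_left ih

theorem idealJ_succ_le (N : Subgroup Γ) (k : ℕ) : idealJ R N (k + 1) ≤ idealJ R N k :=
  sup_le_sup_right (augIdeal_pow_succ_le k) _

theorem mul_mem_idealJ_succ {N : Subgroup Γ} {k : ℕ} {a b : MonoidAlgebra R Γ}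
    (ha : a ∈ augIdeal R Γ) (hb : b ∈ idealJ R N k) : a * b ∈ idealJ R N (k + 1) := by
  obtain ⟨x, hx, y, hy, rfl⟩ := Submodule.mem_sup.1 hb
  rw [mul_add]
  exact add_mem (Ideal.mem_sup_left (mul_mem_augIdeal_pow_succ ha hx))
    (Ideal.mem_sup_right (Ideal.mul_mem_left _ _ hy))

variable {V : Type u} [AddCommGroup V] [Module R V]

/-- The invariants of order `q` are the vectors annihilated by `J_{q+1}`. -/
theorem mem_higherInvariants_iff {ρ : Representation R Γ V} {N : Subgroup Γ} {q : ℕ} {v : V} :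
    v ∈ higherInvariants ρ N q ↔ ∀ a ∈ idealJ R N (q + 1), ρ.asAlgebraHom a v = 0 := by
  have hof (σ : Γ) : ρ.asAlgebraHom (MonoidAlgebra.of R Γ σ - 1) v = ρ σ v - v := by
    simp
  constructor
  · rintro ⟨h₁, h₂⟩ a ha
    obtain ⟨x, hx, y, hy, rfl⟩ := Submodule.mem_sup.1 ha
    rw [map_add, LinearMap.add_apply, h₁ x hx, zero_add]
    refine Submodule.span_induction ?_ (by simp) (fun a b _ _ ha hb => ?_) (fun a b _ hb => ?_) hy
    · rintro _ ⟨σ, hσ, rfl⟩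
      rw [hof, h₂ σ hσ, sub_self]
    · rw [map_add, LinearMap.add_apply, ha, hb, add_zero]
    · rw [smul_eq_mul, map_mul, Module.End.mul_apply, hb, map_zero]
  · refine fun h => ⟨fun a ha => h a (Ideal.mem_sup_left ha), fun σ hσ => ?_⟩
    rw [← sub_eq_zero, ← hof]
    exact h _ (Ideal.mem_sup_right (Ideal.subset_span ⟨σ, hσ, rfl⟩))

/-- A vector on which `I` acts by zero is fixed by the group. -/
theorem apply_eq_self_of_mem_higherInvariants_zero {ρ : Representation R Γ V} {N : Subgroup Γ}
    {v : V} (hv : v ∈ higherInvariants ρ N 0) (γ : Γ) : ρ γ v = v := by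
  have := hv.1 _ (by rw [zero_add, Submodule.pow_one]; exact of_sub_one_mem_augIdeal γ)
  rw [← sub_eq_zero]
  simpa using this

/-- The action of `A` on a vector fixed by the group is through the augmentation. -/
theorem asAlgebraHom_apply_of_fixed {ρ : Representation R Γ V} {v : V} (hv : ∀ γ, ρ γ v = v)
    (a : MonoidAlgebra R Γ) :
    ρ.asAlgebraHom a v = MonoidAlgebra.lift R R Γ (1 : Γ →* R) a • v := by
  induction a using MonoidAlgebra.induction_on with
  | of g => simp [hv]
  | add a b ha hb => simp [ha, hb, add_smul]
  | smul r a ha => simp [ha, mul_smul]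

theorem mem_higherInvariants_zero_of_fixed {ρ : Representation R Γ V} {N : Subgroup Γ} {v : V}
    (hv : ∀ γ, ρ γ v = v) : v ∈ higherInvariants ρ N 0 := by
  refine ⟨fun a ha => ?_, fun σ _ => hv σ⟩
  rw [zero_add, Submodule.pow_one] at ha
  rw [asAlgebraHom_apply_of_fixed hv, show MonoidAlgebra.lift R R Γ (1 : Γ →* R) a = 0 from ha,
    zero_smul]

end Algebra

/-! ### Deck transformations -/

section Covering

variable {X Y : Type u} [TopologicalSpace X] [TopologicalSpace Y] [SimplyConnectedSpace X]
  [LocallySimplyConnectedSpace Y] {π : X → Y} (hπ : IsCoveringMap π) (x₀ : X)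

theorem surjective_of_isCoveringMap {X Y : Type u} [TopologicalSpace X] [TopologicalSpace Y]
    [Nonempty X] [PathConnectedSpace Y] {π : X → Y} (hπ : IsCoveringMap π) :
    Function.Surjective π := fun y =>
  let x : X := Classical.arbitrary X
  ⟨_, (hπ.monodromy (.mk (PathConnectedSpace.somePath (π x) y)) ⟨x, rfl⟩).2⟩

/-- The fundamental group acts transitively on the fibres of the universal covering. -/
theorem exists_deckHom_eq {x x' : X} (h : π x = π x') : ∃ γ, deckHom hπ x₀ γ x = x' := by
  have := LocallySimplyConnectedSpace.locallyPathConnectedSpace Y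
  have := locallyPathConnectedSpace_of_isLocalHomeomorph hπ.isLocalHomeomorph
  obtain ⟨F, ⟨hFx, hF⟩, -⟩ :=
    hπ.existsUnique_continuousMap_lifts ⟨π, hπ.continuous⟩ x x' h.symm
  let Γ : Path.Homotopic.Quotient x₀ (F x₀) := .mk (PathConnectedSpace.somePath _ _)
  let γ : FundamentalGroup Y (π x₀) :=
    (Γ.map ⟨π, hπ.continuous⟩).cast rfl (congrFun hF x₀).symm
  refine ⟨γ⁻¹, ?_⟩
  have hF' : F = deckMap hπ x₀ γ := by
    refine eq_deckMap hπ x₀ γ F ?_ (congrFun hF)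
    have := hπ.monodromy_eq_of_map_eq (γ := γ) (ex := ⟨x₀, rfl⟩) (ey := ⟨F x₀, congrFun hF x₀⟩) Γ
      (Path.Homotopic.Quotient.cast_rfl_rfl _).symm
    exact (congrArg Subtype.val this).symm
  change deckMap hπ x₀ γ⁻¹⁻¹ x = x'
  rw [inv_inv, ← hF', hFx]

/-- The fundamental group acts freely on the universal covering. -/
theorem eq_one_of_deckHom_eq {γ : FundamentalGroup Y (π x₀)} {x : X}
    (h : deckHom hπ x₀ γ x = x) : γ = 1 := by
  have := LocallySimplyConnectedSpace.locallyPathConnectedSpace Y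
  have := locallyPathConnectedSpace_of_isLocalHomeomorph hπ.isLocalHomeomorph
  rw [← inv_eq_one]
  change deckMap hπ x₀ γ⁻¹ x = x at h
  generalize γ⁻¹ = δ at h ⊢
  have hid : deckMap hπ x₀ δ = ContinuousMap.id X :=
    (hπ.existsUnique_continuousMap_lifts ⟨π, hπ.continuous⟩ x x rfl).unique
      ⟨h, funext (proj_deckMap hπ x₀ δ)⟩ ⟨rfl, rfl⟩
  have hm : hπ.monodromy δ ⟨x₀, rfl⟩ = ⟨x₀, rfl⟩ :=
    Subtype.ext ((deckMap_base hπ x₀ δ).symm.trans (by rw [hid]; rfl))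
  have key := hπ.map_liftPathQuotient δ ⟨x₀, rfl⟩
  generalize hπ.liftPathQuotient δ ⟨x₀, rfl⟩ = Γ at key
  generalize hπ.monodromy δ ⟨x₀, rfl⟩ = m at hm Γ key
  subst hm
  rw [Subsingleton.elim Γ (.refl x₀)] at key
  exact (Path.Homotopic.Quotient.cast_rfl_rfl δ).symm.trans key.symm

end Covering

/-! ### Descent of sections along a surjective local homeomorphism -/

section Descent

variable {R : Type u} [CommRing R] {Y : TopCat.{u}} {X : Type u} [TopologicalSpace X] {π : X → Y}

theorem section_ext_of_surjective {X : Type u} {π : X → Y} (hs : Function.Surjective π)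
    (F : TopCat.Sheaf (ModuleCat.{u} R) Y) {U : Opens Y} {t t' : F.presheaf.obj (op U)}
    (h : ∀ x (hx : π x ∈ U), F.presheaf.germ U (π x) hx t = F.presheaf.germ U (π x) hx t') :
    t = t' := by
  refine TopCat.Presheaf.section_ext F U t t' fun y hy => ?_
  obtain ⟨x, rfl⟩ := hs y
  exact h x hy

/-- Germs of `F` indexed by the points of `π ⁻¹ U` which only depend on the image in `U` and which
are locally germs of sections of `F` glue to a section of `F` over `U`. -/
theorem exists_section_of_germs (hs : Function.Surjective π) (hπ : IsOpenMap π)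
    (F : TopCat.Sheaf (ModuleCat.{u} R) Y) (U : Opens Y)
    (s : ∀ x, π x ∈ U → F.presheaf.stalk (π x))
    (hc : ∀ x x' (hx : π x ∈ U) (hx' : π x' ∈ U) (e : π x = π x'),
      stalkCast F e (s x hx) = s x' hx')
    (hl : ∀ x, π x ∈ U → ∃ (V : Opens Y) (t : F.presheaf.obj (op V)), ∃ W ∈ 𝓝 x, ∀ z ∈ W,
      ∀ hz : π z ∈ U, ∃ h : π z ∈ V, s z hz = F.presheaf.germ V (π z) h t) :
    ∃ t : F.presheaf.obj (op U), ∀ x (hx : π x ∈ U), F.presheaf.germ U (π x) hx t = s x hx := by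
  -- Near each point of `U`, openness of `π` gives a section with the prescribed germs.
  have loc : ∀ y : U, ∃ (V : Opens Y) (_ : y.1 ∈ V) (_ : V ≤ U) (t : F.presheaf.obj (op V)),
      ∀ x (hx : π x ∈ V) (hx' : π x ∈ U), F.presheaf.germ V (π x) hx t = s x hx' := by
    rintro ⟨y, hy⟩
    obtain ⟨x, rfl⟩ := hs y
    obtain ⟨V, t, W, hW, h⟩ := hl x hy
    obtain ⟨W', hW', hoW', hxW'⟩ := mem_nhds_iff.1 hW
    let O : Opens Y := ⟨π '' W', hπ _ hoW'⟩ ⊓ (V ⊓ U)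
    refine ⟨O, ⟨⟨x, hxW', rfl⟩, (h x (mem_of_mem_nhds hW) hy).1, hy⟩,
      inf_le_right.trans inf_le_right,
      F.presheaf.map (homOfLE (inf_le_right.trans inf_le_left : O ≤ V)).op t, ?_⟩
    intro z hz hz'
    obtain ⟨z', hz'W, e⟩ := hz.1
    have hz'U : π z' ∈ U := e ▸ hz'
    obtain ⟨hV, e'⟩ := h z' (hW' hz'W) hz'U
    rw [← hc z' z hz'U hz' e, e', stalkCast_germ]
    exact TopCat.Presheaf.germ_res_apply _ _ _ _ _
  choose V hyV hVU t ht using loc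
  have hcompat : TopCat.Presheaf.IsCompatible F.1 V t := by
    intro y y'
    refine section_ext_of_surjective hs F fun x hx => ?_
    refine (TopCat.Presheaf.germ_res_apply F.presheaf _ _ _ _).trans
      (Eq.trans ?_ (TopCat.Presheaf.germ_res_apply F.presheaf _ _ _ _).symm)
    exact (ht y x hx.1 (hVU y hx.1)).trans (ht y' x hx.2 (hVU y hx.1)).symm
  obtain ⟨g, hg, -⟩ := F.existsUnique_gluing' V U (fun y => homOfLE (hVU y))
    (fun y hy => Opens.mem_iSup.2 ⟨⟨y, hy⟩, hyV _⟩) t hcompat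
  refine ⟨g, fun x hx => ?_⟩
  rw [← ht ⟨π x, hx⟩ x (hyV _) hx, ← hg]
  exact (TopCat.Presheaf.germ_res_apply F.presheaf _ _ _ _).symm

end Descent

/-! ### Invariants of order zero are global sections -/

section OrderZero

variable {R : Type u} [CommRing R] {Y : TopCat.{u}} {X : Type u} [TopologicalSpace X]
  [SimplyConnectedSpace X] [LocallySimplyConnectedSpace Y] {π : X → Y}
  (hπ : IsCoveringMap π) (x₀ : X)

theorem sectionsRep_apply (F : TopCat.Sheaf (ModuleCat.{u} R) Y) (γ : FundamentalGroup Y (π x₀))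
    (s : pullbackSections π F) (x : X) :
    (sectionsRep hπ x₀ F γ s).1 x =
      stalkCast F (proj_deckHom hπ x₀ γ⁻¹ x) (s.1 (deckHom hπ x₀ γ⁻¹ x)) :=
  rfl

/-- Values of translates of a section at translated points: `(γ s)(γ x) = s(x)`. -/
theorem sectionsRep_apply_deckHom (F : TopCat.Sheaf (ModuleCat.{u} R) Y)
    (γ : FundamentalGroup Y (π x₀)) (s : pullbackSections π F) (x : X) :
    (sectionsRep hπ x₀ F γ s).1 (deckHom hπ x₀ γ x) =
      stalkCast F (proj_deckHom hπ x₀ γ x).symm (s.1 x) := by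
  have hx : x = deckHom hπ x₀ γ⁻¹ (deckHom hπ x₀ γ x) := by
    rw [map_inv]; exact ((deckHom hπ x₀ γ).symm_apply_apply x).symm
  rw [sectionsRep_apply, ← stalkCast_section F s.1 hx, stalkCast_trans]

/-- The pullback to `X` of a global section of `F`. -/
def pullbackGlobalSection (F : TopCat.Sheaf (ModuleCat.{u} R) Y) :
    F.presheaf.obj (op ⊤) →ₗ[R] pullbackSections π F where
  toFun t := ⟨fun x => F.presheaf.germ ⊤ (π x) trivial t,
    fun _ => ⟨⊤, t, Set.univ, Filter.univ_mem, fun _ _ => ⟨trivial, rfl⟩⟩⟩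
  map_add' _ _ := Subtype.ext (funext fun _ => map_add _ _ _)
  map_smul' _ _ := Subtype.ext (funext fun _ => map_smul (ModuleCat.Hom.hom _) _ _)

theorem sectionsRep_pullbackGlobalSection (F : TopCat.Sheaf (ModuleCat.{u} R) Y)
    (t : F.presheaf.obj (op ⊤)) (γ : FundamentalGroup Y (π x₀)) :
    sectionsRep hπ x₀ F γ (pullbackGlobalSection F t) = pullbackGlobalSection F t :=
  Subtype.ext (funext fun _ => stalkCast_germ F _ ⊤ trivial t)

variable [PathConnectedSpace Y]

/-- A section of `π^* F` on `X` descends to `Y` if and only if it is invariant under deck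
transformations. -/
theorem bijective_pullbackGlobalSection (F : TopCat.Sheaf (ModuleCat.{u} R) Y)
    (N : Subgroup (FundamentalGroup Y (π x₀))) :
    Function.Bijective ((pullbackGlobalSection F).codRestrict
      (higherInvariants (sectionsRep hπ x₀ F) N 0) fun t =>
        mem_higherInvariants_zero_of_fixed (sectionsRep_pullbackGlobalSection hπ x₀ F t)) := by
  have hs := surjective_of_isCoveringMap hπ
  constructor
  · intro t t' h
    exact section_ext_of_surjective hs F fun x _ => congr($(h).1.1 x)
  · rintro ⟨s, hsN⟩
    have hc (x x') (_ : π x ∈ (⊤ : Opens Y)) (_ : π x' ∈ (⊤ : Opens Y)) (e : π x = π x') :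
        stalkCast F e (s.1 x) = s.1 x' := by
      obtain ⟨γ, rfl⟩ := exists_deckHom_eq hπ x₀ e
      rw [← sectionsRep_apply_deckHom, apply_eq_self_of_mem_higherInvariants_zero hsN]
    obtain ⟨t, ht⟩ := exists_section_of_germs hs hπ.isLocalHomeomorph.isOpenMap F ⊤
      (fun x _ => s.1 x) hc fun x _ =>
        let ⟨V, t, W, hW, h⟩ := s.2 x
        ⟨V, t, W, hW, fun z hz _ => h z hz⟩
    exact ⟨t, Subtype.ext (Subtype.ext (funext fun x => ht x trivial))⟩

/-- `H⁰(Y, F) ≅ H⁰_{0,C}(Y, F)`, naturally in `F`. -/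
def globalSectionsIso (R : Type u) [CommRing R] (N : Subgroup (FundamentalGroup Y (π x₀))) :
    globalSections R Y ≅ higherSections hπ x₀ R N 0 :=
  NatIso.ofComponents
    (fun F => (LinearEquiv.ofBijective _ (bijective_pullbackGlobalSection hπ x₀ F N)).toModuleIso)
    fun {F G} f => by
      refine ModuleCat.hom_ext (LinearMap.ext fun t =>
        Subtype.ext (Subtype.ext (funext fun x => ?_)))
      exact (TopCat.Presheaf.stalkFunctor_map_germ_apply ⊤ (π x) trivial f.hom t).symm

end OrderZero

/-! ### Local systems -/

section LocalSystem

variable {R : Type u} [CommRing R] {Y : TopCat.{u}} {X : Type u} [TopologicalSpace X]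
  [SimplyConnectedSpace X] [LocallySimplyConnectedSpace Y] {π : X → Y}
  (hπ : IsCoveringMap π) (x₀ : X)
  {V W : Type u} [AddCommGroup V] [Module R V] [AddCommGroup W] [Module R W]

/-- The sections over `U` of the local system on `Y` attached to a representation `τ` of the
fundamental group: the equivariant locally constant maps `π ⁻¹ U → V`. -/
def localSystemSections (τ : Representation R (FundamentalGroup Y (π x₀)) V) (U : Opens Y) :
    Submodule R ({x // π x ∈ U} → V) where
  carrier := {f | (∀ γ x x', x'.1 = deckHom hπ x₀ γ x.1 → f x' = τ γ (f x)) ∧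
    ∀ x, ∀ᶠ z in 𝓝 x.1, ∀ hz, f ⟨z, hz⟩ = f x}
  add_mem' {f g} hf hg := by
    refine ⟨fun γ x x' h => ?_, fun x => ?_⟩
    · rw [Pi.add_apply, Pi.add_apply, map_add, hf.1 γ x x' h, hg.1 γ x x' h]
    · filter_upwards [hf.2 x, hg.2 x] with z h h' hz
      rw [Pi.add_apply, Pi.add_apply, h, h']
  zero_mem' := ⟨fun γ _ _ _ => (map_zero (τ γ)).symm, fun _ => .of_forall fun _ _ => rfl⟩
  smul_mem' c f hf := by
    refine ⟨fun γ x x' h => ?_, fun x => ?_⟩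
    · rw [Pi.smul_apply, Pi.smul_apply, map_smul, hf.1 γ x x' h]
    · filter_upwards [hf.2 x] with z h hz
      rw [Pi.smul_apply, Pi.smul_apply, h]

/-- The local system on `Y` attached to a representation of the fundamental group, as a
presheaf. -/
def localSystem (τ : Representation R (FundamentalGroup Y (π x₀)) V) :
    TopCat.Presheaf (ModuleCat.{u} R) Y where
  obj U := ModuleCat.of R (localSystemSections hπ x₀ τ U.unop)
  map {U U'} i := ModuleCat.ofHom
    { toFun := fun f => ⟨fun x => f.1 ⟨x.1, leOfHom i.unop x.2⟩,
        fun γ _ _ h => f.2.1 γ _ _ h, fun x =>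
          (f.2.2 ⟨x.1, leOfHom i.unop x.2⟩).mono fun _ hz _ => hz _⟩
      map_add' := fun _ _ => rfl
      map_smul' := fun _ _ => rfl }

theorem localSystemSections_apply_deckHom {hπ : IsCoveringMap π} {x₀ : X}
    {τ : Representation R (FundamentalGroup Y (π x₀)) V} {U : Opens Y}
    (f : localSystemSections hπ x₀ τ U) (γ : FundamentalGroup Y (π x₀)) (x : X) (hx : π x ∈ U)
    (hx' : π (deckHom hπ x₀ γ x) ∈ U) :
    f.1 ⟨deckHom hπ x₀ γ x, hx'⟩ = τ γ (f.1 ⟨x, hx⟩) :=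
  f.2.1 γ ⟨x, hx⟩ ⟨_, hx'⟩ rfl

/-- The morphism of local systems induced by an equivariant map. -/
def localSystemMap {τ : Representation R (FundamentalGroup Y (π x₀)) V}
    {τ' : Representation R (FundamentalGroup Y (π x₀)) W} (ι : V →ₗ[R] W)
    (hι : ∀ γ v, ι (τ γ v) = τ' γ (ι v)) : localSystem hπ x₀ τ ⟶ localSystem hπ x₀ τ' where
  app _ := ModuleCat.ofHom
    { toFun := fun f => ⟨fun x => ι (f.1 x),
        fun γ x x' h => (congrArg ι (f.2.1 γ x x' h)).trans (hι _ _),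
        fun x => (f.2.2 x).mono fun _ hz h => congrArg ι (hz h)⟩
      map_add' := fun _ _ => Subtype.ext (funext fun _ => map_add ι _ _)
      map_smul' := fun _ _ => Subtype.ext (funext fun _ => map_smul ι _ _) }
  naturality _ _ _ := rfl

theorem mono_localSystemMap {τ : Representation R (FundamentalGroup Y (π x₀)) V}
    {τ' : Representation R (FundamentalGroup Y (π x₀)) W} (ι : V →ₗ[R] W)
    (hι : ∀ γ v, ι (τ γ v) = τ' γ (ι v)) (hinj : Function.Injective ι) :
    Mono (localSystemMap hπ x₀ ι hι) := by
  have (U : (Opens Y)ᵒᵖ) : Mono ((localSystemMap hπ x₀ ι hι).app U) := by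
    rw [ModuleCat.mono_iff_injective]
    exact fun f g h => Subtype.ext (funext fun x => hinj congr($(h).1 x))
  exact NatTrans.mono_of_mono_app _

variable {τ : Representation R (FundamentalGroup Y (π x₀)) V}

/-- Local systems are locally constant: around every point of `X` there is a sheet on which
any vector is the value of a section. -/
theorem exists_localSystemSections_eq
    (τ : Representation R (FundamentalGroup Y (π x₀)) V) (x : X) :
    ∃ U : Opens Y, ∃ S ∈ 𝓝 x, (∀ z ∈ S, π z ∈ U) ∧
      ∀ v : V, ∃ f : localSystemSections hπ x₀ τ U, ∀ z ∈ S, ∀ hz, f.1 ⟨z, hz⟩ = v := by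
  obtain ⟨e, hxe, he⟩ := hπ.isLocalHomeomorph x
  have hinj : Set.InjOn π e.source := he ▸ e.injOn
  let U : Opens Y := ⟨π '' e.source, hπ.isLocalHomeomorph.isOpenMap _ e.open_source⟩
  refine ⟨U, e.source, e.open_source.mem_nhds hxe, fun z hz => ⟨z, hz, rfl⟩, fun v => ?_⟩
  -- Every point over `U` lies in exactly one translate `γ • e.source` of the sheet.
  have hex : ∀ z : {z // π z ∈ U}, ∃ γ, ∃ w ∈ e.source, z.1 = deckHom hπ x₀ γ w := by
    rintro ⟨z, w, hw, hwz⟩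
    obtain ⟨γ, hγ⟩ := exists_deckHom_eq hπ x₀ hwz
    exact ⟨γ, w, hw, hγ.symm⟩
  choose g w hw hg using hex
  have huniq : ∀ (z : {z // π z ∈ U}) (γ) (w' : X), w' ∈ e.source → z.1 = deckHom hπ x₀ γ w' →
      g z = γ := by
    intro z γ w' hw' h
    have hww' : w z = w' := hinj (hw z) hw' (by
      rw [← proj_deckHom hπ x₀ (g z) (w z), ← hg, h, proj_deckHom hπ x₀ γ w'])
    rw [hg z, hww'] at h
    refine (inv_mul_eq_one.1 (eq_one_of_deckHom_eq hπ x₀ (x := w') ?_)).symm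
    rw [map_mul, map_inv]
    change (deckHom hπ x₀ γ).symm (deckHom hπ x₀ (g z) w') = w'
    rw [h, Homeomorph.symm_apply_apply]
  refine ⟨⟨fun z => τ (g z) v, fun γ z z' h => ?_, fun z => ?_⟩, fun z hz hzU => ?_⟩
  · have : g z' = γ * g z := huniq _ _ (w z) (hw z) (by rw [h, hg z, map_mul]; rfl)
    change τ (g z') v = τ γ (τ (g z) v)
    rw [this, map_mul]; rfl
  · have hmem : deckHom hπ x₀ (g z) '' e.source ∈ 𝓝 z.1 :=
      ((deckHom hπ x₀ (g z)).isOpenMap _ e.open_source).mem_nhds ⟨w z, hw z, (hg z).symm⟩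
    filter_upwards [hmem]
    rintro _ ⟨w', hw', rfl⟩ hz
    rw [huniq ⟨_, hz⟩ (g z) w' hw' rfl]
  · change τ (g ⟨z, hzU⟩) v = v
    rw [huniq ⟨z, hzU⟩ 1 z hz (by rw [map_one]; rfl), map_one]; rfl

variable {hπ x₀}

/-- The germ at `π x` of the image of a section of a local system only depends on the value of
that section at `x`. -/
theorem germ_app_eq_of_apply_eq {F : TopCat.Sheaf (ModuleCat.{u} R) Y}
    (Ψ : localSystem hπ x₀ τ ⟶ F.presheaf) {U U' : Opens Y} {x : X} (hx : π x ∈ U)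
    (hx' : π x ∈ U') (f : localSystemSections hπ x₀ τ U) (f' : localSystemSections hπ x₀ τ U')
    (h : f.1 ⟨x, hx⟩ = f'.1 ⟨x, hx'⟩) :
    F.presheaf.germ U (π x) hx (Ψ.app (op U) f) =
      F.presheaf.germ U' (π x) hx' (Ψ.app (op U') f') := by
  have hUU' : π ⁻¹' (U ⊓ U' : Opens Y) ∈ 𝓝 x :=
    hπ.continuous.continuousAt ((U ⊓ U').isOpen.mem_nhds ⟨hx, hx'⟩)
  obtain ⟨S, hS, hSo, hxS⟩ := mem_nhds_iff.1
    (Filter.inter_mem hUU' ((f.2.2 ⟨x, hx⟩).and (f'.2.2 ⟨x, hx'⟩)))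
  let O : Opens Y := ⟨π '' S, hπ.isLocalHomeomorph.isOpenMap _ hSo⟩
  have hOU : O ≤ U := by
    rintro _ ⟨z, hz, rfl⟩
    exact (hS hz).1.1
  have hOU' : O ≤ U' := by
    rintro _ ⟨z, hz, rfl⟩
    exact (hS hz).1.2
  have hres : (localSystem hπ x₀ τ).map (homOfLE hOU).op f =
      (localSystem hπ x₀ τ).map (homOfLE hOU').op f' := by
    refine Subtype.ext (funext fun ⟨z, hz⟩ => ?_)
    obtain ⟨z', hz', e⟩ := id hz
    obtain ⟨γ, rfl⟩ := exists_deckHom_eq hπ x₀ e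
    change f.1 ⟨_, hOU hz⟩ = f'.1 ⟨_, hOU' hz⟩
    obtain ⟨hzU, hzf, hzf'⟩ := hS hz'
    refine (localSystemSections_apply_deckHom f γ z' hzU.1 _).trans (Eq.trans ?_
      (localSystemSections_apply_deckHom f' γ z' hzU.2 _).symm)
    exact congrArg (τ γ) ((hzf _).trans (h.trans (hzf' _).symm))
  have hxO : π x ∈ O := ⟨x, hxS, rfl⟩
  have key {U₁ : Opens Y} (i : O ⟶ U₁) (f₁ : localSystemSections hπ x₀ τ U₁) :
      F.presheaf.germ U₁ (π x) (leOfHom i hxO) (Ψ.app (op U₁) f₁) =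
        F.presheaf.germ O (π x) hxO (Ψ.app (op O) ((localSystem hπ x₀ τ).map i.op f₁)) := by
    rw [← TopCat.Presheaf.germ_res_apply F.presheaf i (π x) hxO]
    exact congrArg (F.presheaf.germ O (π x) hxO) congr($(Ψ.naturality i.op).hom f₁).symm
  rw [key (homOfLE hOU) f, key (homOfLE hOU') f', hres]

/-- A morphism from the local system of `V` to a sheaf `F` comes from an equivariant map
`V → H⁰(X, π^* F)`. -/
theorem exists_linearMap_of_hom {F : TopCat.Sheaf (ModuleCat.{u} R) Y}
    (Ψ : localSystem hπ x₀ τ ⟶ F.presheaf) :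
    ∃ φ : V →ₗ[R] pullbackSections π F, (∀ γ v, φ (τ γ v) = sectionsRep hπ x₀ F γ (φ v)) ∧
      ∀ (U : Opens Y) (f : localSystemSections hπ x₀ τ U) (x : X) (hx : π x ∈ U),
        (φ (f.1 ⟨x, hx⟩)).1 x = F.presheaf.germ U (π x) hx (Ψ.app (op U) f) := by
  choose U S hS hSU f hf using exists_localSystemSections_eq hπ x₀ τ
  have hxU (x : X) : π x ∈ U x := hSU x x (mem_of_mem_nhds (hS x))
  have hfx (x : X) (v : V) : (f x v).1 ⟨x, hxU x⟩ = v := hf x v x (mem_of_mem_nhds (hS x)) _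
  let val (v : V) (x : X) : F.presheaf.stalk (π x) :=
    F.presheaf.germ (U x) (π x) (hxU x) (Ψ.app (op (U x)) (f x v))
  have hval {U' : Opens Y} (f' : localSystemSections hπ x₀ τ U') (x : X) (hx : π x ∈ U') :
      val (f'.1 ⟨x, hx⟩) x = F.presheaf.germ U' (π x) hx (Ψ.app (op U') f') :=
    germ_app_eq_of_apply_eq Ψ _ _ _ _ (hfx x _)
  let φ : V →ₗ[R] pullbackSections π F :=
    { toFun := fun v => ⟨val v, fun x => ⟨U x, Ψ.app (op (U x)) (f x v), S x, hS x, fun z hz =>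
        ⟨hSU x z hz, by rw [← hval, hf x v z hz]⟩⟩⟩
      map_add' := fun v v' => Subtype.ext (funext fun x => by
        have := hval (f x v + f x v') x (hxU x)
        rw [show (f x v + f x v').1 ⟨x, hxU x⟩ = v + v' from
          congrArg₂ (· + ·) (hfx x v) (hfx x v')] at this
        refine this.trans ?_
        exact (congrArg (F.presheaf.germ (U x) (π x) (hxU x))
          (map_add (Ψ.app (op (U x))).hom (f x v) (f x v'))).trans (map_add _ _ _))
      map_smul' := fun c v => Subtype.ext (funext fun x => by
        have := hval (c • f x v) x (hxU x)
        rw [show (c • f x v).1 ⟨x, hxU x⟩ = c • v from congrArg (c • ·) (hfx x v)] at this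
        refine this.trans ?_
        exact (congrArg (F.presheaf.germ (U x) (π x) (hxU x))
          (map_smul (Ψ.app (op (U x))).hom c (f x v))).trans
            (map_smul (F.presheaf.germ (U x) (π x) (hxU x)).hom _ _)) }
  refine ⟨φ, fun γ v => Subtype.ext (funext fun x' => ?_), fun U' f' x hx => hval f' x hx⟩
  obtain ⟨x, rfl⟩ := (deckHom hπ x₀ γ).surjective x'
  have hγx : π (deckHom hπ x₀ γ x) ∈ U x := by rw [proj_deckHom hπ x₀ γ x]; exact hxU x
  have h₁ : τ γ v = (f x v).1 ⟨_, hγx⟩ := by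
    rw [localSystemSections_apply_deckHom (f x v) γ x (hxU x), hfx]
  rw [sectionsRep_apply_deckHom]
  change val (τ γ v) _ = stalkCast F _ (val v x)
  rw [stalkCast_germ, h₁, hval]

variable [PathConnectedSpace Y]

/-- An equivariant map `V → H⁰(X, π^* F)` induces a morphism from the local system of `V` to
the sheaf `F`. -/
theorem exists_hom_of_linearMap {F : TopCat.Sheaf (ModuleCat.{u} R) Y}
    (φ : V →ₗ[R] pullbackSections π F) (hφ : ∀ γ v, φ (τ γ v) = sectionsRep hπ x₀ F γ (φ v)) :
    ∃ Ψ : localSystem hπ x₀ τ ⟶ F.presheaf,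
      ∀ (U : Opens Y) (f : localSystemSections hπ x₀ τ U) (x : X) (hx : π x ∈ U),
        F.presheaf.germ U (π x) hx (Ψ.app (op U) f) = (φ (f.1 ⟨x, hx⟩)).1 x := by
  have hs := surjective_of_isCoveringMap hπ
  have hex (U : Opens Y) (f : localSystemSections hπ x₀ τ U) :
      ∃ t : F.presheaf.obj (op U), ∀ x (hx : π x ∈ U),
        F.presheaf.germ U (π x) hx t = (φ (f.1 ⟨x, hx⟩)).1 x := by
    refine exists_section_of_germs hs hπ.isLocalHomeomorph.isOpenMap F U _ ?_ fun x hx => ?_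
    · intro x x' hx hx' e
      obtain ⟨γ, rfl⟩ := exists_deckHom_eq hπ x₀ e
      rw [localSystemSections_apply_deckHom f γ x hx, hφ, sectionsRep_apply_deckHom]
    · obtain ⟨U', t, S, hS, h⟩ := (φ (f.1 ⟨x, hx⟩)).2 x
      refine ⟨U', t, _, Filter.inter_mem hS (f.2.2 ⟨x, hx⟩), fun z hz hzU => ?_⟩
      rw [hz.2 hzU]
      exact h z hz.1
  choose t ht using hex
  let ψ (U : Opens Y) : localSystemSections hπ x₀ τ U →ₗ[R] F.presheaf.obj (op U) :=
    { toFun := t U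
      map_add' := fun f f' => section_ext_of_surjective hs F fun x hx => ?_
      map_smul' := fun c f => section_ext_of_surjective hs F fun x hx => ?_ }
  · refine ⟨{ app := fun U => ModuleCat.ofHom (ψ U.unop), naturality := fun U U' i => ?_ }, ht⟩
    refine ModuleCat.hom_ext (LinearMap.ext fun f =>
      section_ext_of_surjective hs F fun x hx => ?_)
    refine (ht _ _ x hx).trans (Eq.symm ?_)
    exact (TopCat.Presheaf.germ_res_apply F.presheaf i.unop (π x) hx _).trans (ht _ f x _)
  · rw [map_add, ht, ht, ht]
    exact congr($(map_add φ (f.1 ⟨x, hx⟩) (f'.1 ⟨x, hx⟩)).1 x)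
  · refine Eq.trans ?_ (map_smul (F.presheaf.germ U (π x) hx).hom c _).symm
    refine (ht _ _ x hx).trans (Eq.trans ?_ (congrArg (c • ·) (ht _ f x hx)).symm)
    exact congr($(map_smul φ c (f.1 ⟨x, hx⟩)).1 x)

/-- If `F` is an injective sheaf, then `H⁰(X, π^* F)` is an injective representation of the
fundamental group. Indeed `F ↦ H⁰(X, π^* F)` is right adjoint to the formation of local systems,
which preserves injections. -/
theorem exists_equivariant_extension {F : TopCat.Sheaf (ModuleCat.{u} R) Y} [Injective F]
    {τ' : Representation R (FundamentalGroup Y (π x₀)) W} (ι : V →ₗ[R] W)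
    (hι : ∀ γ v, ι (τ γ v) = τ' γ (ι v)) (hinj : Function.Injective ι)
    (φ : V →ₗ[R] pullbackSections π F) (hφ : ∀ γ v, φ (τ γ v) = sectionsRep hπ x₀ F γ (φ v)) :
    ∃ φ' : W →ₗ[R] pullbackSections π F,
      (∀ γ w, φ' (τ' γ w) = sectionsRep hπ x₀ F γ (φ' w)) ∧ ∀ v, φ' (ι v) = φ v := by
  -- A sheaf that is injective among sheaves is injective among presheaves.
  have : Injective (C := Sheaf (Opens.grothendieckTopology Y) (ModuleCat.{u} R)) F := ‹Injective F›
  have : Injective F.presheaf :=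
    Injective.injective_of_adjoint
      (sheafificationAdjunction (Opens.grothendieckTopology Y) (ModuleCat.{u} R)) F
  have := mono_localSystemMap hπ x₀ ι hι hinj
  obtain ⟨Ψ, hΨ⟩ := exists_hom_of_linearMap φ hφ
  obtain ⟨φ', hφ', h⟩ :=
    exists_linearMap_of_hom (Injective.factorThru Ψ (localSystemMap hπ x₀ ι hι))
  refine ⟨φ', hφ', fun v => Subtype.ext (funext fun x => ?_)⟩
  obtain ⟨U, S, hS, hSU, hf⟩ := exists_localSystemSections_eq hπ x₀ τ x
  obtain ⟨f, hf⟩ := hf v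
  have hxU := hSU x (mem_of_mem_nhds hS)
  have hfx : f.1 ⟨x, hxU⟩ = v := hf x (mem_of_mem_nhds hS) hxU
  have h₁ := h U ((localSystemMap hπ x₀ ι hι).app (op U) f) x hxU
  have h₂ := hΨ U f x hxU
  rw [hfx] at h₂
  rw [← h₂]
  refine Eq.trans ?_ (h₁.trans (congrArg (F.presheaf.germ U (π x) hxU) ?_))
  · exact congr((φ' (ι $(hfx.symm))).1 x)
  · exact congr(($(Injective.comp_factorThru Ψ (localSystemMap hπ x₀ ι hι)).app (op U)).hom f)

end LocalSystem

/-! ### Raising the order of invariants -/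

section Filtration

variable {R : Type u} [CommRing R] {Γ : Type u} [Group Γ] {N : Subgroup Γ}
  {V W V' : Type u} [AddCommGroup V] [Module R V] [AddCommGroup W] [Module R W]
  [AddCommGroup V'] [Module R V']

theorem map_asAlgebraHom {ρ : Representation R Γ V} {τ : Representation R Γ W}
    (f : V →ₗ[R] W) (hf : ∀ γ v, f (ρ γ v) = τ γ (f v)) (a : MonoidAlgebra R Γ) (v : V) :
    f (ρ.asAlgebraHom a v) = τ.asAlgebraHom a (f v) := by
  induction a using MonoidAlgebra.induction_on with
  | of g => simp [hf]
  | add a b ha hb => simp [ha, hb]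
  | smul r a ha => simp [ha]

theorem higherInvariants_le_succ (ρ : Representation R Γ V) (N : Subgroup Γ) (q : ℕ) :
    higherInvariants ρ N q ≤ higherInvariants ρ N (q + 1) := fun _ hv =>
  ⟨fun a ha => hv.1 a (augIdeal_pow_succ_le _ ha), hv.2⟩

/-- The homomorphism `J_{q+1} / J_{q+2} → V^Γ`, `j ↦ j v`, attached to an invariant `v` of
order `q + 1`. It vanishes if and only if `v` is an invariant of order `q`. -/
def gradedAction (ρ : Representation R Γ V) {q : ℕ} (v : higherInvariants ρ N (q + 1)) :
    gradedJ R N (q + 1) →ₗ[R] higherInvariants ρ N 0 :=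
  Submodule.liftQ _
    { toFun := fun j => ⟨ρ.asAlgebraHom j.1 v.1, by
        refine mem_higherInvariants_zero_of_fixed fun γ => ?_
        have h := mem_higherInvariants_iff.1 v.2 _
          (mul_mem_idealJ_succ (of_sub_one_mem_augIdeal γ) j.2)
        rw [map_mul, Module.End.mul_apply] at h
        rw [← sub_eq_zero, ← h]
        simp⟩
      map_add' := fun i j => Subtype.ext (by simp)
      map_smul' := fun c j => Subtype.ext (by simp) }
    fun j hj => Subtype.ext (mem_higherInvariants_iff.1 v.2 j.1 hj)

theorem gradedAction_mk (ρ : Representation R Γ V) {q : ℕ} (v : higherInvariants ρ N (q + 1))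
    (j : (idealJ R N (q + 1)).restrictScalars R) :
    (gradedAction ρ v (Submodule.Quotient.mk j)).1 = ρ.asAlgebraHom j.1 v.1 :=
  rfl

/-- Let `V → W → V'` be equivariant maps. If the sequences of invariants of order `0` and of
order `q` are exact at `W`, then so is the sequence of invariants of order `q + 1`, provided that
`J_{q+1} / J_{q+2}` is projective and that every homomorphism `J_{q+1} / J_{q+2} → V^Γ` is the
action on an invariant of order `q + 1` of `V`. -/
theorem exact_higherInvariants_succ {ρ : Representation R Γ V} {τ : Representation R Γ W}
    {ρ' : Representation R Γ V'} (f : V →ₗ[R] W) (hf : ∀ γ v, f (ρ γ v) = τ γ (f v))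
    (g : W →ₗ[R] V') (hg : ∀ γ w, g (τ γ w) = ρ' γ (g w)) {q : ℕ}
    [Module.Projective R (gradedJ R N (q + 1))]
    (hsurj : Function.Surjective (gradedAction ρ (N := N) (q := q)))
    (h₀ : ∀ w ∈ higherInvariants τ N 0, g w = 0 → ∃ v ∈ higherInvariants ρ N 0, f v = w)
    (hq : ∀ w ∈ higherInvariants τ N q, g w = 0 → ∃ v ∈ higherInvariants ρ N q, f v = w)
    (hfg : ∀ v, g (f v) = 0) :
    ∀ w ∈ higherInvariants τ N (q + 1), g w = 0 →
      ∃ v ∈ higherInvariants ρ N (q + 1), f v = w := by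
  intro w hw hgw
  let f₀ : higherInvariants ρ N 0 →ₗ[R] higherInvariants τ N 0 :=
    f.restrict fun _ h => map_mem_higherInvariants f hf N 0 h
  -- The action on the cocycle `w` takes values in cocycles, hence in coboundaries, and lifts.
  have hrange (x : gradedJ R N (q + 1)) : gradedAction τ ⟨w, hw⟩ x ∈ LinearMap.range f₀ := by
    obtain ⟨j, rfl⟩ := Submodule.Quotient.mk_surjective _ x
    obtain ⟨v, hv, h⟩ := h₀ _ (gradedAction τ ⟨w, hw⟩ (Submodule.Quotient.mk j)).2 (by
      rw [gradedAction_mk, map_asAlgebraHom g hg, hgw, map_zero])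
    exact ⟨⟨v, hv⟩, Subtype.ext h⟩
  obtain ⟨η, hη⟩ := Module.projective_lifting_property f₀.rangeRestrict
    ((gradedAction τ ⟨w, hw⟩).codRestrict _ hrange) f₀.surjective_rangeRestrict
  obtain ⟨⟨v, hv⟩, rfl⟩ := hsurj η
  -- Subtracting a coboundary, the action on `w` becomes trivial and its order drops.
  obtain ⟨v', hv', h⟩ := hq (w - f v) (mem_higherInvariants_iff.2 fun a ha => by
    have h : (f₀ (gradedAction ρ ⟨v, hv⟩ (Submodule.Quotient.mk ⟨a, ha⟩))).1 = _ :=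
      congr(($hη (Submodule.Quotient.mk ⟨a, ha⟩)).1.1)
    change f (ρ.asAlgebraHom a v) = τ.asAlgebraHom a w at h
    rw [map_sub, ← h, map_asAlgebraHom f hf, sub_self]) (by rw [map_sub, hgw, hfg, sub_zero])
  exact ⟨v + v', add_mem hv (higherInvariants_le_succ ρ N q hv'), by
    rw [map_add, h, add_sub_cancel]⟩

/-- The representation of `Γ` on a left ideal of `R[Γ]` by left multiplication. -/
def idealRep (J : Ideal (MonoidAlgebra R Γ)) : Representation R Γ (J.restrictScalars R) where
  toFun γ :=
    { toFun := fun j => ⟨MonoidAlgebra.of R Γ γ * j.1, J.mul_mem_left _ j.2⟩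
      map_add' := fun _ _ => Subtype.ext (mul_add _ _ _)
      map_smul' := fun _ _ => Subtype.ext (mul_smul_comm _ _ _) }
  map_one' := LinearMap.ext fun j => Subtype.ext (by
    change MonoidAlgebra.of R Γ 1 * j.1 = j.1
    rw [map_one, one_mul])
  map_mul' γ δ := LinearMap.ext fun j => Subtype.ext (by
    change MonoidAlgebra.of R Γ (γ * δ) * j.1 = _ * (_ * j.1)
    rw [map_mul, mul_assoc])

/-- The representation of `Γ` on `R[Γ]` by left multiplication. -/
def groupAlgebraRep (R : Type u) [CommRing R] (Γ : Type u) [Group Γ] :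
    Representation R Γ (MonoidAlgebra R Γ) :=
  (Algebra.lmul R (MonoidAlgebra R Γ)).toMonoidHom.comp (MonoidAlgebra.of R Γ)

end Filtration

section Injective

variable {R : Type u} [CommRing R] {Y : TopCat.{u}} {X : Type u} [TopologicalSpace X]
  [SimplyConnectedSpace X] [LocallySimplyConnectedSpace Y] [PathConnectedSpace Y] {π : X → Y}
  {hπ : IsCoveringMap π} {x₀ : X}

/-- For an injective sheaf `F`, the homomorphisms `J_{q+1} / J_{q+2} → H⁰(X, π^* F)^Γ` extend to
the whole group algebra, hence are given by the action on an invariant of order `q + 1`. -/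
theorem surjective_gradedAction (F : TopCat.Sheaf (ModuleCat.{u} R) Y) [Injective F]
    (N : Subgroup (FundamentalGroup Y (π x₀))) (q : ℕ) :
    Function.Surjective (gradedAction (sectionsRep hπ x₀ F) (N := N) (q := q)) := by
  intro θ
  let J := idealJ R N (q + 1)
  let φ : J.restrictScalars R →ₗ[R] pullbackSections π F :=
    (higherInvariants (sectionsRep hπ x₀ F) N 0).subtype ∘ₗ θ ∘ₗ Submodule.mkQ _
  have hφ (γ) (j : J.restrictScalars R) :
      φ (idealRep J γ j) = sectionsRep hπ x₀ F γ (φ j) := by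
    refine Eq.trans ?_ (apply_eq_self_of_mem_higherInvariants_zero
      (θ (Submodule.Quotient.mk j)).2 γ).symm
    refine congrArg (fun x => (θ x).1) ((Submodule.Quotient.eq _).2 ?_)
    have h := mul_mem_idealJ_succ (of_sub_one_mem_augIdeal γ) j.2
    rw [sub_mul, one_mul] at h
    exact h
  obtain ⟨φ', hφ', h⟩ := exists_equivariant_extension (τ := idealRep J)
    (τ' := groupAlgebraRep R _) (J.restrictScalars R).subtype (fun _ _ => rfl)
    Subtype.val_injective φ hφ
  -- The extension to the group algebra is the action on the image of `1`.
  have key (a : MonoidAlgebra R (FundamentalGroup Y (π x₀))) :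
      (sectionsRep hπ x₀ F).asAlgebraHom a (φ' 1) = φ' a := by
    induction a using MonoidAlgebra.induction_on with
    | of γ =>
      rw [Representation.asAlgebraHom_of, ← hφ']
      exact congrArg φ' (mul_one _)
    | add a b ha hb => rw [map_add, LinearMap.add_apply, ha, hb, map_add]
    | smul r a ha => rw [map_smul, LinearMap.smul_apply, ha, map_smul]
  have hJ : idealJ R N (q + 2) ≤ J := idealJ_succ_le N (q + 1)
  refine ⟨⟨φ' 1, mem_higherInvariants_iff.2 fun a ha => ?_⟩, LinearMap.ext fun x => ?_⟩
  · rw [key]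
    refine (h ⟨a, hJ ha⟩).trans ?_
    change (θ (Submodule.Quotient.mk _)).1 = 0
    rw [(Submodule.Quotient.mk_eq_zero _).2 (show (⟨a, hJ ha⟩ : J.restrictScalars R) ∈ _ from ha),
      map_zero]
    rfl
  · obtain ⟨j, rfl⟩ := Submodule.Quotient.mk_surjective _ x
    exact Subtype.ext ((key j.1).trans (h j))

end Injective

/-! ### Acyclic sheaves -/

section Acyclic

/-- Naturally isomorphic functors have naturally isomorphic derived functors. -/
def rightDerivedIso {C D : Type*} [Category C] [Category D] [Abelian C] [HasInjectiveResolutions C]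
    [Abelian D] {T T' : C ⥤ D} [T.Additive] [T'.Additive] (e : T ≅ T') (n : ℕ) :
    T.rightDerived n ≅ T'.rightDerived n where
  hom := NatTrans.rightDerived e.hom n
  inv := NatTrans.rightDerived e.inv n
  hom_inv_id := by rw [← NatTrans.rightDerived_comp, e.hom_inv_id, NatTrans.rightDerived_id]
  inv_hom_id := by rw [← NatTrans.rightDerived_comp, e.inv_hom_id, NatTrans.rightDerived_id]

/-- The derived functors of `T` in positive degrees are computed by elements of the complex
obtained from an injective resolution. -/
theorem isZero_rightDerived_obj_iff {R : Type u} [CommRing R] {𝒞 : Type*} [Category 𝒞] [Abelian 𝒞]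
    [HasInjectiveResolutions 𝒞] (T : 𝒞 ⥤ ModuleCat.{u} R) [T.Additive] {F : 𝒞}
    (I : InjectiveResolution F) (p : ℕ) :
    Limits.IsZero ((T.rightDerived (p + 1)).obj F) ↔
      Function.Exact (T.map (I.cocomplex.d p (p + 1))) (T.map (I.cocomplex.d (p + 1) (p + 2))) := by
  rw [(I.isoRightDerivedObj T (p + 1)).isZero_iff]
  refine (HomologicalComplex.exactAt_iff_isZero_homology _ _).symm.trans ?_
  rw [HomologicalComplex.exactAt_iff' _ p (p + 1) (p + 2) (by simp) (by simp),
    ShortComplex.ShortExact.moduleCat_exact_iff_function_exact]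
  rfl

variable {R : Type u} [CommRing R] {Y : TopCat.{u}}

theorem pullbackSectionsMap_pullbackSectionsMap_eq_zero {X : Type u} [TopologicalSpace X]
    {π : X → Y} {F G H : TopCat.Sheaf (ModuleCat.{u} R) Y} {f : F ⟶ G} {g : G ⟶ H} (hfg : f ≫ g = 0)
    (s : pullbackSections π F) : pullbackSectionsMap π g (pullbackSectionsMap π f s) = 0 := by
  refine Subtype.ext (funext fun x => ?_)
  have h₁ := (TopCat.Presheaf.stalkFunctor (ModuleCat.{u} R) (π x)).map_comp f.hom g.hom
  have h₂ : f.hom ≫ g.hom = 0 := congr(($hfg).hom)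
  rw [h₂, Functor.map_zero] at h₁
  exact congr(($h₁).hom (s.1 x)).symm

variable {X : Type u} [TopologicalSpace X] [SimplyConnectedSpace X] [LocallySimplyConnectedSpace Y]
  {π : X → Y} {hπ : IsCoveringMap π} {x₀ : X}

theorem exact_higherSections_map_iff {N : Subgroup (FundamentalGroup Y (π x₀))} {q : ℕ}
    {F G H : TopCat.Sheaf (ModuleCat.{u} R) Y} (f : F ⟶ G) (g : G ⟶ H) (hfg : f ≫ g = 0) :
    Function.Exact ((higherSections hπ x₀ R N q).map f) ((higherSections hπ x₀ R N q).map g) ↔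
      ∀ s ∈ higherInvariants (sectionsRep hπ x₀ G) N q, pullbackSectionsMap π g s = 0 →
        ∃ t ∈ higherInvariants (sectionsRep hπ x₀ F) N q, pullbackSectionsMap π f t = s := by
  constructor
  · intro h s hs hgs
    obtain ⟨⟨t, ht⟩, e⟩ := (h ⟨s, hs⟩).1 (Subtype.ext hgs)
    exact ⟨t, ht, congrArg Subtype.val e⟩
  · refine fun h s => ⟨fun hgs => ?_, ?_⟩
    · obtain ⟨t, ht, e⟩ := h s.1 s.2 (congrArg Subtype.val hgs)
      exact ⟨⟨t, ht⟩, Subtype.ext e⟩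
    · rintro ⟨t, rfl⟩
      have : (higherSections hπ x₀ R N q).map f ≫ (higherSections hπ x₀ R N q).map g = 0 := by
        rw [← Functor.map_comp, hfg, Functor.map_zero]
      exact congr(($this).hom t)

/-- If `F` is acyclic for the invariants of order `0`, then it is acyclic for the invariants of
order `q`: on an injective resolution, passing from order `q` to order `q + 1` adds the exact
functor `Hom(J_{q+1} / J_{q+2}, ·)` applied to the invariants of order `0`. -/
theorem isAcyclicFor_higherSections [PathConnectedSpace Y]
    {N : Subgroup (FundamentalGroup Y (π x₀))}
    {F : TopCat.Sheaf (ModuleCat.{u} R) Y} (hF : IsAcyclicFor (higherSections hπ x₀ R N 0) F)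
    (q : ℕ) (hfree : ∀ k, 1 ≤ k → k ≤ q → Module.Free R (gradedJ R N k)) :
    IsAcyclicFor (higherSections hπ x₀ R N q) F := by
  induction q with
  | zero => exact hF
  | succ q ih =>
    have ih := ih fun k h₁ h₂ => hfree k h₁ (h₂.trans q.le_succ)
    have := hfree (q + 1) (by omega) le_rfl
    intro p hp
    obtain ⟨p, rfl⟩ := Nat.exists_eq_add_of_le' hp
    let I := injectiveResolution F
    have h₀ := hF (p + 1) hp
    have hq := ih (p + 1) hp
    have hd := I.cocomplex.d_comp_d p (p + 1) (p + 2)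
    have := I.injective p
    rw [isZero_rightDerived_obj_iff _ I, exact_higherSections_map_iff _ _ hd] at h₀ hq ⊢
    exact exact_higherInvariants_succ _ (pullbackSectionsMap_sectionsRep hπ x₀ _)
      _ (pullbackSectionsMap_sectionsRep hπ x₀ _) (surjective_gradedAction _ N q) h₀ hq
      (pullbackSectionsMap_pullbackSectionsMap_eq_zero hd)

end Acyclic

end HigherOrder

end

theorem mainTheorem9 (R : Type u) [CommRing R] (Y : TopCat.{u}) [PathConnectedSpace Y]
    [HigherOrder.LocallySimplyConnectedSpace Y]
    {X : Type u} [TopologicalSpace X] [SimplyConnectedSpace X] {π : X → Y} (hπ : IsCoveringMap π)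
    {C : Type u} [TopologicalSpace C] {p : C → Y} (hp : HigherOrder.IsNormalCovering p)
    (x₀ : X) (c₀ : C) (h : p c₀ = π x₀) (hX : ContractibleSpace X) :
    (∀ n : ℕ, Nonempty
      (HigherOrder.higherSheafCohomology hπ x₀ R
          (HigherOrder.coveringSubgroup hp.isCoveringMap h) 0 n ≅
        HigherOrder.sheafCohomology R Y n)) ∧
    ∀ q : ℕ,
      (∀ k : ℕ, 1 ≤ k → k ≤ q → Module.Free R
        (HigherOrder.gradedJ R (HigherOrder.coveringSubgroup hp.isCoveringMap h) k)) →
      ∀ F : TopCat.Sheaf (ModuleCat.{u} R) Y,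
        HigherOrder.IsAcyclicFor (HigherOrder.globalSections R Y) F →
        HigherOrder.IsAcyclicFor
          (HigherOrder.higherSections hπ x₀ R
            (HigherOrder.coveringSubgroup hp.isCoveringMap h) q) F := by
  have e (n : ℕ) := HigherOrder.rightDerivedIso
    (HigherOrder.globalSectionsIso hπ x₀ R (HigherOrder.coveringSubgroup hp.isCoveringMap h)) n
  refine ⟨fun n => ⟨(e n).symm⟩, fun q hfree F hF => ?_⟩
  exact HigherOrder.isAcyclicFor_higherSections
    (fun n hn => ((e n).app F).isZero_iff.1 (hF n hn)) q hfree
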